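/- Let $n\ge 1$, let $f:\mathbb R^n\to[0,\infty)$ be not identically zero, even, integrable and log-concave (that is, $f=e^{-v}$ with $v:\mathbb R^n\to(-\infty,+\infty]$ convex), and let $t_0\in(0,1]$. Write $\|f\|_\infty=\sup f$, $K_t=K_t(f)=\{x: f(x)\ge t\|f\|_\infty\}$, and let $r(K)$ be the radius of the largest centered Euclidean ball contained in $K$, with $r(\emptyset)=0$. An ellipsoidal function is $\mathcal E^a=a\chi_{\mathcal E}$ with $a>0$ and $\mathcal E=c+TB_2^n$, $c\in\mathbb R^n$, $T\in GL(n)$. John's ellipsoid $\mathcal E(f)$ is the unique ellipsoidal function $\le f$ whose integral is maximal among all ellipsoidal functions $\le f$. Assume that $(B_2^n)^{t_0\|f\|_\infty}\le f$. Then $t\mapsto r(K_t)$ has one-sided derivatives at $t_0$ in $[-\infty,+\infty]$ (if $t_0=1$ then $K_t=\emptyset$ for $t>1$, so the right derivative is $-\infty$ and the lower bound on $\alpha_i$ below is void), and the following are equivalent: 1. $\mathcal E(f)=(B_2^n)^{t_0\|f\|_\infty}$. 2. There exist an integer $1\le m\le 1+\frac{n(n+1)}2$, integers $n\le m'(i)\le\frac{n(n+1)}2$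 for $1\le i\le m$, points $u_{ij}\in\partial K_{t_0}\cap S^{n-1}$, numbers $\lambda_i>0$, $\mu_{ij}>0$ ($1\le i\le m$, $1\le j\le m'(i)$), and numbers $$\alpha_i\in\Big[t_0\tfrac{d}{dt^+}r(K_t)\big|_{t=t_0},\ t_0\tfrac{d}{dt^-}r(K_t)\big|_{t=t_0}\Big]$$ such that $$\sum_{i=1}^m\lambda_i\alpha_i=-1,\qquad I_n=\sum_{i=1}^m\sum_{j=1}^{m'(i)}\lambda_i\mu_{ij}\,u_{ij}\otimes u_{ij},$$ and for every $t\in(0,1]$, every $1\le i\le m$ and every $T\in GL(n)$ with $TB_2^n\subseteq K_t$, $$-\alpha_i\log\Big(\frac t{t_0}\Big)+\sum_{j=1}^{m'(i)}\mu_{ij}\langle Tu_{ij},u_{ij}\rangle\le\sum_{j=1}^{m'(i)}\mu_{ij}.$$ -/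

import Mathlib

open MeasureTheory Filter Topology

noncomputable section

/-- A function `f = e^{-v}` with `v : ℝⁿ → (-∞, +∞]` convex: `v = -log f` is finite exactly where
`f ≠ 0`, this set is convex, and `v` is convex on it. -/
def IsLogConcave {n : ℕ} (f : EuclideanSpace ℝ (Fin n) → ℝ) : Prop :=
  (∀ x, 0 ≤ f x) ∧ ConvexOn ℝ {x | f x ≠ 0} (fun x => -Real.log (f x))

/-- The supremum norm of a function. -/
def supNorm {n : ℕ} (f : EuclideanSpace ℝ (Fin n) → ℝ) : ℝ :=
  ⨆ x, |f x|

/-- The level set `K_t(f) = {x : f x ≥ t ‖f‖_∞}`. -/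
def levelSet {n : ℕ} (f : EuclideanSpace ℝ (Fin n) → ℝ) (t : ℝ) :
    Set (EuclideanSpace ℝ (Fin n)) :=
  {x | t * supNorm f ≤ f x}

/-- The closed Euclidean unit ball `B_2^n`. -/
def unitBall (n : ℕ) : Set (EuclideanSpace ℝ (Fin n)) :=
  Metric.closedBall 0 1

/-- The function `A^a = a χ_A`. -/
def levelFun {n : ℕ} (A : Set (EuclideanSpace ℝ (Fin n))) (a : ℝ) :
    EuclideanSpace ℝ (Fin n) → ℝ :=
  A.indicator (fun _ => a)

/-- The ellipsoid `c + T B_2^n` with `T ∈ GL(n)`. -/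
def ellipsoid {n : ℕ} (c : EuclideanSpace ℝ (Fin n))
    (T : EuclideanSpace ℝ (Fin n) ≃ₗ[ℝ] EuclideanSpace ℝ (Fin n)) :
    Set (EuclideanSpace ℝ (Fin n)) :=
  (fun x => c + T x) '' unitBall n

/-- Ellipsoidal functions: `a χ_A` with `a > 0` and `A` an ellipsoid, not necessarily centered. -/
def IsEllipsoidal {n : ℕ} (g : EuclideanSpace ℝ (Fin n) → ℝ) : Prop :=
  ∃ a : ℝ, 0 < a ∧ ∃ c T, g = levelFun (ellipsoid c T) a

/-- `g` is an ellipsoidal function below `f` of the largest possible integral. -/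
def IsJohnEllipsoid {n : ℕ} (f g : EuclideanSpace ℝ (Fin n) → ℝ) : Prop :=
  IsEllipsoidal g ∧ (∀ x, g x ≤ f x) ∧
    ∀ h : EuclideanSpace ℝ (Fin n) → ℝ, IsEllipsoidal h → (∀ x, h x ≤ f x) →
      ∫ x, h x ≤ ∫ x, g x

/-- The radius of the largest centered Euclidean ball contained in `K`; it is `0` for `K = ∅`. -/
def inradius {n : ℕ} (K : Set (EuclideanSpace ℝ (Fin n))) : ℝ :=
  sSup {ρ : ℝ | 0 ≤ ρ ∧ Metric.closedBall 0 ρ ⊆ K}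

/-- `D ∈ [-∞, +∞]` is the right derivative of `g` at `x`. -/
def HasRightDeriv (g : ℝ → ℝ) (x : ℝ) (D : EReal) : Prop :=
  Tendsto (fun t => (((g t - g x) / (t - x) : ℝ) : EReal)) (𝓝[>] x) (𝓝 D)

/-- `D ∈ [-∞, +∞]` is the left derivative of `g` at `x`. -/
def HasLeftDeriv (g : ℝ → ℝ) (x : ℝ) (D : EReal) : Prop :=
  Tendsto (fun t => (((g t - g x) / (t - x) : ℝ) : EReal)) (𝓝[<] x) (𝓝 D)

end

/-! ### Determinant and trace; polar decomposition. -/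

namespace Matrix

variable {n : ℕ}

/-! Write levels as t = exp s. Log-concavity makes the set of pairs (s, T) with T B ⊆ K_t convex
(`IsLogConcave.combo_mem_levelSet`). Evenness allows ellipsoids to be centred at 0, so maximal
integral means maximal s + log |det T| on that set. At (s₀, I) the linearisation is (*): s - s₀ + tr
T ≤ n for all admissible pairs. Maximality implies (*) by differentiating along segments
(`IsJohnEllipsoid.sub_add_trace_le`). Conversely, by polar decomposition T may be taken positive
definite, and then log det T ≤ tr T - n (`isJohnEllipsoid_of_forall_posDef`).

If (2) holds, adding its inequalities with weights λ_i gives (*), since the decomposition of the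
identity turns the inner products into tr T. If (*) holds, its case s = s₀ is the hypothesis of
John's theorem for K_{t₀} (`exists_john_decomposition`, by Hahn-Banach separation). The resulting
points turn (*) itself into the inequality of (2), with m = 1, λ = n and α = -1/n. This α lies in
the required interval: applying (*) to multiples of I bounds r(K_t) by 1 - log (t / t₀) / n, with
equality at t₀.

The one-sided derivatives exist because s ↦ r(K_{exp s}) is concave on s ≤ 0, so its slopes are
monotone. -/

theorem det_toEuclideanLin (A : Matrix (Fin n) (Fin n) ℝ) :
    LinearMap.det (toEuclideanLin A) = A.det := by
  rw [toEuclideanLin_eq_toLin_orthonormal, LinearMap.det_toLin]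

theorem trace_toEuclideanLin (A : Matrix (Fin n) (Fin n) ℝ) :
    LinearMap.trace ℝ _ (toEuclideanLin A) = A.trace := by
  rw [toEuclideanLin_eq_toLin_orthonormal, Matrix.trace_toLin_eq]

theorem norm_toEuclideanLin_of_transpose_mul_self {U : Matrix (Fin n) (Fin n) ℝ} (hU : Uᵀ * U = 1)
    (x : EuclideanSpace ℝ (Fin n)) : ‖toEuclideanLin U x‖ = ‖x‖ := by
  have h : ‖toEuclideanLin U x‖ ^ 2 = ‖x‖ ^ 2 := by
    rw [← real_inner_self_eq_norm_sq, ← real_inner_self_eq_norm_sq,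
      ← LinearMap.adjoint_inner_left, ← toEuclideanLin_conjTranspose_eq_adjoint,
      conjTranspose_eq_transpose_of_trivial]
    congr 1
    simp [toLpLin_apply, hU]
  exact (sq_eq_sq₀ (norm_nonneg _) (norm_nonneg _)).1 h

open scoped MatrixOrder in
/-- The part of the polar decomposition that concerns the image of the unit ball. -/
theorem exists_posDef_image_closedBall_eq {A : Matrix (Fin n) (Fin n) ℝ} (hA : A.det ≠ 0) :
    ∃ P : Matrix (Fin n) (Fin n) ℝ, P.PosDef ∧ |A.det| = P.det ∧
      toEuclideanLin A '' Metric.closedBall 0 1 = toEuclideanLin P '' Metric.closedBall 0 1 := by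
  have hpsd : (A * Aᵀ).PosSemidef := by
    simpa [conjTranspose_eq_transpose_of_trivial] using posSemidef_self_mul_conjTranspose A
  -- In A = P U with U orthogonal, U preserves the ball, so A and P have the same image of it.
  set P := CFC.sqrt (A * Aᵀ) with hPdef
  have hPP : P * P = A * Aᵀ := CFC.sqrt_mul_sqrt_self _ (nonneg_iff_posSemidef.2 hpsd)
  have hP : P.PosSemidef := nonneg_iff_posSemidef.1 (CFC.sqrt_nonneg _)
  have hPdet : P.det * P.det = A.det * A.det := by
    rw [← det_mul, hPP, det_mul, det_transpose]
  have hP0 : P.det ≠ 0 := fun h => by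
    rw [h] at hPdet
    simp [hA] at hPdet
  have hPu : IsUnit P.det := isUnit_iff_ne_zero.2 hP0
  have hPt : Pᵀ = P := by
    simpa [conjTranspose_eq_transpose_of_trivial] using hP.1.eq
  set U := P⁻¹ * A with hUdef
  have hPU : P * U = A := by rw [hUdef, mul_nonsing_inv_cancel_left _ _ hPu]
  have hU1 : U * Uᵀ = 1 := by
    rw [hUdef, transpose_mul, transpose_nonsing_inv, hPt,
      show P⁻¹ * A * (Aᵀ * P⁻¹) = P⁻¹ * (A * Aᵀ) * P⁻¹ by simp only [Matrix.mul_assoc], ← hPP,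
      nonsing_inv_mul_cancel_left _ _ hPu, mul_nonsing_inv _ hPu]
  have hU2 : Uᵀ * U = 1 := mul_eq_one_comm.1 hU1
  have hU3 : Uᵀᵀ * Uᵀ = 1 := by rwa [transpose_transpose]
  refine ⟨P, hP.posDef_iff_det_ne_zero.2 hP0, ?_, ?_⟩
  · have := hP.det_nonneg
    rw [← abs_of_nonneg this]
    exact abs_eq_iff_mul_self_eq.2 hPdet.symm
  · ext y
    constructor
    · rintro ⟨x, hx, rfl⟩
      refine ⟨toEuclideanLin U x, ?_, ?_⟩
      · simpa [norm_toEuclideanLin_of_transpose_mul_self hU2] using hx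
      · simp [toLpLin_apply, hPU]
    · rintro ⟨x, hx, rfl⟩
      refine ⟨toEuclideanLin Uᵀ x, ?_, ?_⟩
      · simpa [norm_toEuclideanLin_of_transpose_mul_self hU3] using hx
      · simp only [toLpLin_apply, mulVec_mulVec]
        rw [← hPU, Matrix.mul_assoc, hU1, Matrix.mul_one]

theorem PosDef.log_det_eq_sum {P : Matrix (Fin n) (Fin n) ℝ} (hP : P.PosDef) :
    Real.log P.det = ∑ i, Real.log (hP.1.eigenvalues i) := by
  rw [hP.1.det_eq_prod_eigenvalues]
  simpa using Real.log_prod (s := Finset.univ) fun i _ => (hP.eigenvalues_pos i).ne'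

theorem PosDef.trace_sub_card_eq_sum {P : Matrix (Fin n) (Fin n) ℝ} (hP : P.PosDef) :
    P.trace - n = ∑ i, (hP.1.eigenvalues i - 1) := by
  rw [hP.1.trace_eq_sum_eigenvalues]
  simp

/-- Apply log x ≤ x - 1 to each eigenvalue; equality forces every eigenvalue to be 1. -/
theorem PosDef.log_det_le {P : Matrix (Fin n) (Fin n) ℝ} (hP : P.PosDef) :
    Real.log P.det ≤ P.trace - n := by
  rw [hP.log_det_eq_sum, hP.trace_sub_card_eq_sum]
  exact Finset.sum_le_sum fun i _ => Real.log_le_sub_one_of_pos (hP.eigenvalues_pos i)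

theorem PosDef.eq_one_of_le_log_det {P : Matrix (Fin n) (Fin n) ℝ} (hP : P.PosDef)
    (h : P.trace - n ≤ Real.log P.det) : P = 1 := by
  have hle : ∀ i ∈ Finset.univ, Real.log (hP.1.eigenvalues i) ≤ hP.1.eigenvalues i - 1 :=
    fun i _ => Real.log_le_sub_one_of_pos (hP.eigenvalues_pos i)
  have heq := (Finset.sum_eq_sum_iff_of_le hle).1
    (by rw [← hP.log_det_eq_sum, ← hP.trace_sub_card_eq_sum]; exact hP.log_det_le.antisymm h)
  have h1 : hP.1.eigenvalues = 1 := by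
    funext i
    by_contra hi
    exact (Real.log_lt_sub_one_of_pos (hP.eigenvalues_pos i) hi).ne (heq i (Finset.mem_univ i))
  have := hP.1.spectral_theorem
  rw [h1] at this
  rw [this]
  simp

theorem hasDerivAt_det_one_add_smul (A : Matrix (Fin n) (Fin n) ℝ) :
    HasDerivAt (fun ε : ℝ => (1 + ε • A).det) A.trace 0 := by
  have h : (fun ε : ℝ => (1 + ε • A).det) = fun ε =>
      1 + A.trace * ε +
        ((det (1 + (Polynomial.X : Polynomial ℝ) • A.map Polynomial.C)).divX.divX).eval ε * ε ^ 2 := by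
    funext ε
    rw [det_one_add_smul]
  rw [h]
  have := (((hasDerivAt_id (0 : ℝ)).const_mul A.trace).const_add 1).add
    ((((det (1 + (Polynomial.X : Polynomial ℝ) • A.map Polynomial.C)).divX.divX).hasDerivAt
      (0 : ℝ)).mul ((hasDerivAt_id (0 : ℝ)).pow 2))
  simpa [Pi.add_def, Pi.mul_def, Pi.pow_def] using this

/-- Substitute the decomposition of the identity into tr (A · 1). -/
theorem sum_inner_eq_trace {ι : Type*} [Fintype ι] (c : ι → ℝ)
    (u : ι → EuclideanSpace ℝ (Fin n))
    (h : (1 : Matrix (Fin n) (Fin n) ℝ) = ∑ j, c j • vecMulVec (u j) (u j))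
    (A : Matrix (Fin n) (Fin n) ℝ) :
    ∑ j, c j * inner ℝ (toEuclideanLin A (u j)) (u j) = A.trace := by
  have h1 : A.trace = (A * ∑ j, c j • vecMulVec (u j) (u j)).trace := by rw [← h, Matrix.mul_one]
  rw [h1, Matrix.mul_sum, trace_sum]
  refine Finset.sum_congr rfl fun j _ => ?_
  rw [mul_smul_comm, trace_smul, smul_eq_mul, mul_vecMulVec, trace_vecMulVec,
    EuclideanSpace.inner_eq_star_dotProduct]
  simp [ofLp_toLpLin, dotProduct_comm]

end Matrix

/-! ### John's decomposition of the identity at contact points. -/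

section JohnDecomposition

variable {n : ℕ}

/-- First-order perturbation: points interior to K tolerate small moves, and near a contact point
the move decreases the norm. Compactness makes ε uniform. -/
theorem eventually_add_smul_mem_of_inner_neg {K : Set (EuclideanSpace ℝ (Fin n))}
    (hB : Metric.closedBall 0 1 ⊆ K)
    (H : EuclideanSpace ℝ (Fin n) →ₗ[ℝ] EuclideanSpace ℝ (Fin n))
    (hH : ∀ u ∈ frontier K ∩ Metric.sphere 0 1, inner ℝ (H u) u < 0) :
    ∀ᶠ ε : ℝ in 𝓝[>] 0, ∀ x ∈ Metric.closedBall (0 : EuclideanSpace ℝ (Fin n)) 1,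
      x + ε • H x ∈ K := by
  have hHc : Continuous H := H.continuous_of_finiteDimensional
  -- The conditions on ε and x are repeated as hypotheses because the compactness argument works on
  -- full neighbourhoods of (0, x).
  have key : ∀ᶠ ε : ℝ in 𝓝 0, ∀ x ∈ Metric.closedBall (0 : EuclideanSpace ℝ (Fin n)) 1,
      0 < ε → x ∈ Metric.closedBall (0 : EuclideanSpace ℝ (Fin n)) 1 → x + ε • H x ∈ K := by
    refine (isCompact_closedBall _ _).eventually_forall_of_forall_eventually fun x hx => ?_
    by_cases hxi : x ∈ interior K
    · have hc : Continuous fun z : ℝ × EuclideanSpace ℝ (Fin n) => z.2 + z.1 • H z.2 := by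
        fun_prop
      have hmem : (fun z : ℝ × EuclideanSpace ℝ (Fin n) => z.2 + z.1 • H z.2) (0, x) ∈ interior K := by
        simpa using hxi
      filter_upwards [hc.continuousAt.eventually (isOpen_interior.mem_nhds hmem)] with z hz _ _
      exact interior_subset hz
    · have hx1 : x ∈ Metric.sphere (0 : EuclideanSpace ℝ (Fin n)) 1 := by
        by_contra hne
        refine hxi (interior_mono (Metric.ball_subset_closedBall.trans hB) ?_)
        rw [Metric.isOpen_ball.interior_eq]
        exact lt_of_le_of_ne hx hne
      have hneg := hH x ⟨⟨subset_closure (hB hx), hxi⟩, hx1⟩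
      have hc : Continuous fun z : ℝ × EuclideanSpace ℝ (Fin n) =>
          2 * inner ℝ (H z.2) z.2 + z.1 * ‖H z.2‖ ^ 2 := by fun_prop
      have hlt : (fun z : ℝ × EuclideanSpace ℝ (Fin n) =>
          2 * inner ℝ (H z.2) z.2 + z.1 * ‖H z.2‖ ^ 2) (0, x) < 0 := by
        simp only
        linarith
      filter_upwards [hc.continuousAt.eventually (gt_mem_nhds hlt)] with z hz hε hzB
      apply hB
      rw [mem_closedBall_zero_iff] at hzB ⊢
      have h1 : ‖z.2 + z.1 • H z.2‖ ^ 2 =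
          ‖z.2‖ ^ 2 + z.1 * (2 * inner ℝ (H z.2) z.2 + z.1 * ‖H z.2‖ ^ 2) := by
        rw [norm_add_sq_real, inner_smul_right, norm_smul, mul_pow, Real.norm_eq_abs, sq_abs,
          real_inner_comm]
        ring
      have h2 : z.1 * (2 * inner ℝ (H z.2) z.2 + z.1 * ‖H z.2‖ ^ 2) ≤ 0 :=
        mul_nonpos_of_nonneg_of_nonpos hε.le hz.le
      have h3 : ‖z.2‖ ^ 2 ≤ 1 := pow_le_one₀ (norm_nonneg _) hzB
      exact (sq_le_one_iff₀ (norm_nonneg _)).1 (by linarith)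
  filter_upwards [nhdsWithin_le_nhds key, self_mem_nhdsWithin] with ε h hε x hx
  exact h x hx hε hx

theorem exists_inner_eq_of_linearMap (φ : (Fin n → Fin n → ℝ) →ₗ[ℝ] ℝ) :
    ∃ H : Matrix (Fin n) (Fin n) ℝ,
      (∀ u : EuclideanSpace ℝ (Fin n),
        inner ℝ (Matrix.toEuclideanLin H u) u = φ fun a b => u a * u b) ∧
      H.trace = φ fun a b => if a = b then 1 else 0 := by
  have hφ : ∀ x : Fin n → Fin n → ℝ,
      φ x = ∑ a, ∑ b, x a b * φ (Pi.single a (Pi.single b (1 : ℝ))) := by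
    intro x
    have h : x = ∑ a, ∑ b, x a b • Pi.single a (Pi.single b (1 : ℝ)) := by
      ext i j
      simp [Finset.sum_apply, Pi.single_apply, ite_apply]
    conv_lhs => rw [h]
    simp only [map_sum, map_smul, smul_eq_mul]
  refine ⟨Matrix.of fun a b => φ (Pi.single a (Pi.single b (1 : ℝ))), fun u => ?_, ?_⟩
  · rw [hφ, EuclideanSpace.inner_eq_star_dotProduct]
    simp only [Matrix.toLpLin_apply, dotProduct, Matrix.mulVec, Matrix.of_apply, Pi.star_apply,
      star_trivial, Finset.mul_sum]
    exact Finset.sum_congr rfl fun a _ => Finset.sum_congr rfl fun b _ => by ring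
  · rw [hφ]
    simp [Matrix.trace]

/-- A point of the convex hull of the matrices `u ⊗ u`, with `u` in a set of unit vectors, is a
positive combination of at most `n (n + 1) / 2` of them. -/
theorem exists_le_card_of_mem_convexHull_outer {S : Set (EuclideanSpace ℝ (Fin n))}
    (hS : S ⊆ Metric.sphere 0 1) {x : Fin n → Fin n → ℝ}
    (hx : x ∈ convexHull ℝ
      ((fun (u : EuclideanSpace ℝ (Fin n)) (a b : Fin n) => u a * u b) '' S)) :
    ∃ (k : ℕ) (u : Fin k → EuclideanSpace ℝ (Fin n)) (c : Fin k → ℝ), k ≤ n * (n + 1) / 2 ∧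
      (∀ j, u j ∈ S) ∧ (∀ j, 0 < c j) ∧ ∑ j, c j = 1 ∧
      ∀ a b, x a b = ∑ j, c j * (u j a * u j b) := by
  obtain ⟨ι, _, z, w, hz, hind, hw, hw1, hsum⟩ := eq_pos_convex_span_of_mem_convexHull hx
  choose u huS hu using fun i => hz (Set.mem_range_self i)
  -- All u ⊗ u have trace 1, so affine independence upgrades to linear independence. Symmetric
  -- matrices are functions on `Sym2 (Fin n)`, which has n (n + 1) / 2 elements.
  have hlin : LinearIndependent ℝ fun (i : ι) (p : Sym2 (Fin n)) =>
      Sym2.lift ⟨fun a b => u i a * u i b, fun a b => mul_comm _ _⟩ p := by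
    rw [Fintype.linearIndependent_iff]
    intro g hg
    have hent : ∀ a b, ∑ i, g i * (u i a * u i b) = 0 := by
      intro a b
      have := congrFun hg s(a, b)
      simpa using this
    have hg0 : ∑ i, g i = 0 := by
      have : ∑ a, ∑ i, g i * (u i a * u i a) = 0 := by simp [hent]
      rw [Finset.sum_comm] at this
      rw [← this]
      refine Finset.sum_congr rfl fun i _ => ?_
      have h1 : ‖u i‖ = 1 := by simpa using hS (huS i)
      have h2 : ∑ a, u i a * u i a = 1 := by
        have := EuclideanSpace.real_norm_sq_eq (u i)
        rw [h1] at this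
        simpa [sq] using this.symm
      rw [← Finset.mul_sum, h2, mul_one]
    have hgz : ∑ i, g i • z i = 0 := by
      ext a b
      simpa [← hu] using hent a b
    exact fun i => hind.eq_zero_of_sum_eq_zero hg0 hgz i (Finset.mem_univ i)
  have hcard : Fintype.card ι ≤ n * (n + 1) / 2 := by
    have := hlin.fintype_card_le_finrank
    rwa [Module.finrank_fintype_fun_eq_card, Sym2.card, Fintype.card_fin, Nat.choose_two_right,
      Nat.add_sub_cancel, mul_comm] at this
  let e := Fintype.equivFin ι
  refine ⟨Fintype.card ι, u ∘ e.symm, w ∘ e.symm, hcard, fun j => huS _, fun j => hw _, ?_, ?_⟩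
  · rw [← hw1]
    exact e.symm.sum_comp w
  · intro a b
    rw [← hsum]
    simp only [Finset.sum_apply, Pi.smul_apply, smul_eq_mul, ← hu, Function.comp]
    exact (e.symm.sum_comp fun i => w i * (u i a * u i b)).symm

/-- The decomposition expresses every v through the u_j, so they span. -/
theorem card_le_of_one_eq_sum_vecMulVec {k : ℕ} (c : Fin k → ℝ)
    (u : Fin k → EuclideanSpace ℝ (Fin n))
    (h : (1 : Matrix (Fin n) (Fin n) ℝ) = ∑ j, c j • Matrix.vecMulVec (u j) (u j)) : n ≤ k := by
  have hspan : ⊤ ≤ Submodule.span ℝ (Set.range fun j => (u j : Fin n → ℝ)) := by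
    intro v _
    have hv : v = ∑ j, (c j * (u j : Fin n → ℝ) ⬝ᵥ v) • (u j : Fin n → ℝ) := by
      conv_lhs => rw [← Matrix.one_mulVec v, h, Matrix.sum_mulVec]
      refine Finset.sum_congr rfl fun j _ => ?_
      rw [Matrix.smul_mulVec, Matrix.vecMulVec_mulVec, mul_smul, op_smul_eq_smul]
    rw [hv]
    exact Submodule.sum_mem _ fun j _ =>
      Submodule.smul_mem _ _ (Submodule.subset_span (Set.mem_range_self j))
  have := finrank_range_le_card (R := ℝ) fun j => (u j : Fin n → ℝ)
  rw [Set.finrank, top_le_iff.1 hspan] at this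
  simpa using this

/-- By Carathéodory, the hull is a continuous image of simplex × s^N with N = dim + 1; shorter
combinations are padded with zero weights. -/
theorem IsCompact.convexHull_of_finiteDimensional {V : Type*} [NormedAddCommGroup V]
    [NormedSpace ℝ V] [FiniteDimensional ℝ V] {s : Set V} (hs : IsCompact s) :
    IsCompact (convexHull ℝ s) := by
  rcases s.eq_empty_or_nonempty with rfl | ⟨p, hp⟩
  · simp
  set N := Module.finrank ℝ V + 1 with hN
  have hc : Continuous fun y : (Fin N → ℝ) × (Fin N → V) => ∑ i, y.1 i • y.2 i := by fun_prop
  have hcomp := ((isCompact_stdSimplex ℝ (Fin N)).prod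
    (isCompact_univ_pi fun _ : Fin N => hs)).image hc
  convert hcomp using 1
  ext x
  constructor
  · intro hx
    obtain ⟨ι, _, z, w, hz, hind, hw, hw1, hsum⟩ := eq_pos_convex_span_of_mem_convexHull hx
    have hcard : Fintype.card ι ≤ Fintype.card (Fin N) := by
      rw [Fintype.card_fin]
      exact hind.card_le_finrank_succ.trans (Nat.succ_le_succ (Submodule.finrank_le _))
    obtain ⟨e⟩ := Function.Embedding.nonempty_of_card_le hcard
    have hext : ∀ j, j ∉ Set.range e → Function.extend e w 0 j = 0 := fun j hj =>
      Function.extend_apply' _ _ _ hj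
    refine ⟨(Function.extend e w 0, Function.extend e z fun _ => p), ⟨⟨fun j => ?_, ?_⟩,
      fun j _ => ?_⟩, ?_⟩
    · dsimp only
      by_cases hj : j ∈ Set.range e
      · obtain ⟨i, rfl⟩ := hj
        rw [e.injective.extend_apply]
        exact (hw i).le
      · rw [hext j hj]
    · rw [← hw1]
      exact (Fintype.sum_of_injective e e.injective w _ hext
        fun i => (e.injective.extend_apply w 0 i).symm).symm
    · by_cases hj : j ∈ Set.range e
      · obtain ⟨i, rfl⟩ := hj
        simp only [e.injective.extend_apply]
        exact hz (Set.mem_range_self i)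
      · simpa only [Function.extend_apply' _ _ _ hj] using hp
    · rw [← hsum]
      refine (Fintype.sum_of_injective e e.injective _ _ (fun j hj => ?_) fun i => ?_).symm
      · simp only [hext j hj, zero_smul]
      · simp only [e.injective.extend_apply]
  · rintro ⟨⟨w, z⟩, ⟨⟨hw, hw1⟩, hz⟩, rfl⟩
    exact (convex_convexHull ℝ s).sum_mem (fun i _ => hw i) hw1
      fun i _ => subset_convexHull ℝ s (hz i (Set.mem_univ i))

/-- **John's theorem**: a set containing the unit ball, in which the unit ball is an ellipsoid of
maximal trace, has a John decomposition of the identity at its contact points. -/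
theorem exists_john_decomposition (hn : 1 ≤ n) {K : Set (EuclideanSpace ℝ (Fin n))}
    (hB : Metric.closedBall 0 1 ⊆ K)
    (hK : ∀ T : EuclideanSpace ℝ (Fin n) →ₗ[ℝ] EuclideanSpace ℝ (Fin n),
      (∀ x ∈ Metric.closedBall 0 1, T x ∈ K) → LinearMap.trace ℝ _ T ≤ n) :
    ∃ (k : ℕ) (u : Fin k → EuclideanSpace ℝ (Fin n)) (c : Fin k → ℝ),
      (n ≤ k ∧ k ≤ n * (n + 1) / 2) ∧ (∀ j, u j ∈ frontier K ∩ Metric.sphere 0 1) ∧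
      (∀ j, 0 < c j) ∧ ∑ j, c j = 1 ∧
      (1 : Matrix (Fin n) (Fin n) ℝ) = ∑ j, (n * c j) • Matrix.vecMulVec (u j) (u j) := by
  have hn0 : (0 : ℝ) < n := by exact_mod_cast hn
  set S := frontier K ∩ Metric.sphere (0 : EuclideanSpace ℝ (Fin n)) 1 with hS
  set q := fun (u : EuclideanSpace ℝ (Fin n)) (a b : Fin n) => u a * u b with hq
  set x : Fin n → Fin n → ℝ := fun a b => (n : ℝ)⁻¹ * if a = b then 1 else 0 with hx
  -- Otherwise a functional, represented by a matrix H, separates I / n from the u ⊗ u at some level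
  -- d. Then G = H - d I has ⟨G u, u⟩ < 0 at contact points but positive trace, so I + ε G maps the
  -- ball into K with trace above n.
  have hmem : x ∈ convexHull ℝ (q '' S) := by
    by_contra hnot
    have hSc : IsCompact S := (isCompact_sphere _ _).inter_left isClosed_frontier
    have hqc : Continuous q := by fun_prop
    obtain ⟨φ, d, hφ, hd⟩ := geometric_hahn_banach_closed_point (convex_convexHull ℝ (q '' S))
      (hSc.image hqc).convexHull_of_finiteDimensional.isClosed hnot
    obtain ⟨H, hH1, hH2⟩ := exists_inner_eq_of_linearMap (φ : (Fin n → Fin n → ℝ) →ₗ[ℝ] ℝ)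
    have hev := eventually_add_smul_mem_of_inner_neg hB
      (Matrix.toEuclideanLin H - d • LinearMap.id) (fun u hu => by
        have h1 : ‖u‖ = 1 := by simpa using hu.2
        have h2 := hφ (q u) (subset_convexHull ℝ _ ⟨u, hu, rfl⟩)
        have h3 := hH1 u
        simp only [ContinuousLinearMap.coe_coe] at h3
        rw [LinearMap.sub_apply, inner_sub_left, h3, LinearMap.smul_apply, LinearMap.id_apply,
          inner_smul_left, real_inner_self_eq_norm_sq, h1]
        simp only [hq] at h2
        simpa using h2)
    obtain ⟨ε, hε, hεpos⟩ := (hev.and self_mem_nhdsWithin).exists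
    have hεpos : 0 < ε := hεpos
    have htr := hK (LinearMap.id + ε • (Matrix.toEuclideanLin H - d • LinearMap.id)) hε
    have hxd : φ x = (n : ℝ)⁻¹ * H.trace := by
      rw [hH2, ContinuousLinearMap.coe_coe, ← smul_eq_mul, ← map_smul]
      rfl
    rw [hxd, ← div_eq_inv_mul, lt_div_iff₀ hn0] at hd
    simp only [map_add, map_smul, map_sub, LinearMap.trace_id, Matrix.trace_toEuclideanLin,
      finrank_euclideanSpace_fin, smul_eq_mul] at htr
    have := mul_pos hεpos (sub_pos.2 hd)
    linarith
  obtain ⟨k, u, c, hk, huS, hc, hc1, hxe⟩ :=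
    exists_le_card_of_mem_convexHull_outer (S := S) Set.inter_subset_right hmem
  have hI : (1 : Matrix (Fin n) (Fin n) ℝ) =
      ∑ j, (n * c j) • Matrix.vecMulVec (u j) (u j) := by
    ext a b
    have := hxe a b
    simp only [hx] at this
    rw [Matrix.one_apply, Matrix.sum_apply]
    simp only [Matrix.smul_apply, Matrix.vecMulVec_apply, smul_eq_mul, mul_assoc]
    rw [← Finset.mul_sum, ← this, mul_inv_cancel_left₀ hn0.ne']
  exact ⟨k, u, c, ⟨card_le_of_one_eq_sum_vecMulVec _ _ hI, hk⟩, huS, hc, hc1, hI⟩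

end JohnDecomposition

/-! ### Level sets of even log-concave functions. -/

section LogConcave

variable {n : ℕ} {f : EuclideanSpace ℝ (Fin n) → ℝ}

theorem IsLogConcave.apply_le_apply_zero (hf : IsLogConcave f) (heven : ∀ x, f (-x) = f x)
    (x : EuclideanSpace ℝ (Fin n)) : f x ≤ f 0 := by
  by_cases hx : f x = 0
  · rw [hx]
    exact hf.1 0
  have hx' : f (-x) ≠ 0 := by rwa [heven]
  have hz : (1 / 2 : ℝ) • x + (1 / 2 : ℝ) • (-x) = 0 := by
    rw [smul_neg, add_neg_cancel]
  have h0 : f 0 ≠ 0 := by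
    have := hf.2.1 hx hx' (by norm_num : (0 : ℝ) ≤ 1 / 2) (by norm_num : (0 : ℝ) ≤ 1 / 2)
      (by norm_num)
    rwa [hz] at this
  have := hf.2.2 hx hx' (by norm_num : (0 : ℝ) ≤ 1 / 2) (by norm_num : (0 : ℝ) ≤ 1 / 2)
    (by norm_num)
  simp only [hz, heven, smul_eq_mul] at this
  exact (Real.log_le_log_iff (lt_of_le_of_ne (hf.1 x) (Ne.symm hx))
    (lt_of_le_of_ne (hf.1 0) (Ne.symm h0))).1 (by linarith)

theorem IsLogConcave.supNorm_eq (hf : IsLogConcave f) (heven : ∀ x, f (-x) = f x) :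
    supNorm f = f 0 := by
  have h : ∀ x, |f x| ≤ f 0 := fun x => by
    rw [abs_of_nonneg (hf.1 x)]
    exact hf.apply_le_apply_zero heven x
  refine le_antisymm (ciSup_le h) ?_
  exact (le_abs_self _).trans (le_ciSup ⟨f 0, Set.forall_mem_range.2 h⟩ 0)

theorem IsLogConcave.supNorm_pos (hf : IsLogConcave f) (heven : ∀ x, f (-x) = f x)
    (hne : f ≠ 0) : 0 < supNorm f := by
  obtain ⟨x, hx⟩ := Function.ne_iff.1 hne
  rw [hf.supNorm_eq heven]
  exact (lt_of_le_of_ne (hf.1 x) (Ne.symm hx)).trans_le (hf.apply_le_apply_zero heven x)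

theorem zero_mem_levelSet (hf : IsLogConcave f) (heven : ∀ x, f (-x) = f x) {t : ℝ} (ht : t ≤ 1) :
    (0 : EuclideanSpace ℝ (Fin n)) ∈ levelSet f t := by
  have h0 := hf.1 0
  rw [levelSet, Set.mem_ofPred_eq, hf.supNorm_eq heven]
  nlinarith

theorem levelSet_eq_empty (hf : IsLogConcave f) (heven : ∀ x, f (-x) = f x)
    (h0 : 0 < supNorm f) {t : ℝ} (ht : 1 < t) : levelSet f t = ∅ := by
  refine Set.eq_empty_of_forall_notMem fun x hx => ?_
  have h1 : t * supNorm f ≤ f x := hx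
  have h2 := hf.apply_le_apply_zero heven x
  rw [← hf.supNorm_eq heven] at h2
  nlinarith

/-- The condition f x ≠ 0 is separate because `Real.log 0 = 0`. -/
theorem mem_levelSet_exp_iff (hf : IsLogConcave f) (h0 : 0 < supNorm f) {s : ℝ}
    {x : EuclideanSpace ℝ (Fin n)} :
    x ∈ levelSet f (Real.exp s) ↔ f x ≠ 0 ∧ s + Real.log (supNorm f) ≤ Real.log (f x) := by
  have hpos : 0 < Real.exp s * supNorm f := mul_pos (Real.exp_pos s) h0
  have hlog : Real.log (Real.exp s * supNorm f) = s + Real.log (supNorm f) := by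
    rw [Real.log_mul (Real.exp_ne_zero _) h0.ne', Real.log_exp]
  rw [levelSet, Set.mem_ofPred_eq, ← hlog]
  constructor
  · intro h
    exact ⟨(hpos.trans_le h).ne', Real.log_le_log hpos h⟩
  · rintro ⟨hx, h⟩
    exact (Real.log_le_log_iff hpos (lt_of_le_of_ne (hf.1 x) (Ne.symm hx))).1 h

theorem IsLogConcave.combo_mem_levelSet (hf : IsLogConcave f) (h0 : 0 < supNorm f) {s s' a b : ℝ}
    {x y : EuclideanSpace ℝ (Fin n)} (hx : x ∈ levelSet f (Real.exp s))
    (hy : y ∈ levelSet f (Real.exp s')) (ha : 0 ≤ a) (hb : 0 ≤ b) (hab : a + b = 1) :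
    a • x + b • y ∈ levelSet f (Real.exp (a * s + b * s')) := by
  rw [mem_levelSet_exp_iff hf h0] at *
  refine ⟨hf.2.1 hx.1 hy.1 ha hb hab, ?_⟩
  have h := hf.2.2 hx.1 hy.1 ha hb hab
  simp only [smul_eq_mul] at h
  have h1 := mul_le_mul_of_nonneg_left hx.2 ha
  have h2 := mul_le_mul_of_nonneg_left hy.2 hb
  have h3 : Real.log (supNorm f) = a * Real.log (supNorm f) + b * Real.log (supNorm f) := by
    rw [← add_mul, hab, one_mul]
  linarith

theorem IsLogConcave.convex_levelSet (hf : IsLogConcave f) (h0 : 0 < supNorm f) (s : ℝ) :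
    Convex ℝ (levelSet f (Real.exp s)) := by
  intro x hx y hy a b ha hb hab
  have := hf.combo_mem_levelSet h0 hx hy ha hb hab
  rwa [← add_mul, hab, one_mul] at this

theorem neg_mem_levelSet (heven : ∀ x, f (-x) = f x) {t : ℝ} {x : EuclideanSpace ℝ (Fin n)}
    (hx : x ∈ levelSet f t) : -x ∈ levelSet f t := by
  rw [levelSet, Set.mem_ofPred_eq, heven]
  exact hx

/-! ### Ellipsoidal functions, optimality and uniqueness. -/

theorem levelFun_le_iff (hf : ∀ x, 0 ≤ f x) {A : Set (EuclideanSpace ℝ (Fin n))} {t : ℝ} :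
    (∀ x, levelFun A (t * supNorm f) x ≤ f x) ↔ A ⊆ levelSet f t := by
  constructor
  · intro h x hx
    simpa [levelFun, hx, levelSet] using h x
  · intro h x
    by_cases hx : x ∈ A
    · simpa [levelFun, hx, levelSet] using h hx
    · simpa [levelFun, hx] using hf x

theorem ellipsoid_zero_subset_iff
    {T : EuclideanSpace ℝ (Fin n) ≃ₗ[ℝ] EuclideanSpace ℝ (Fin n)}
    {K : Set (EuclideanSpace ℝ (Fin n))} :
    ellipsoid 0 T ⊆ K ↔ ∀ x ∈ Metric.closedBall 0 1, T x ∈ K := by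
  simp [ellipsoid, unitBall, Set.subset_def]

theorem unitBall_eq_ellipsoid :
    unitBall n = ellipsoid 0 (LinearEquiv.refl ℝ (EuclideanSpace ℝ (Fin n))) := by
  simp [ellipsoid]

theorem ellipsoid_zero_subset_levelSet (hf : IsLogConcave f) (heven : ∀ x, f (-x) = f x)
    (h0 : 0 < supNorm f) {s : ℝ} {c : EuclideanSpace ℝ (Fin n)}
    {T : EuclideanSpace ℝ (Fin n) ≃ₗ[ℝ] EuclideanSpace ℝ (Fin n)}
    (h : ellipsoid c T ⊆ levelSet f (Real.exp s)) : ellipsoid 0 T ⊆ levelSet f (Real.exp s) := by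
  rw [ellipsoid_zero_subset_iff]
  intro x hx
  have h1 : c + T x ∈ levelSet f (Real.exp s) := h ⟨x, hx, rfl⟩
  have h2 : c + T (-x) ∈ levelSet f (Real.exp s) := h ⟨-x, by simpa [unitBall] using hx, rfl⟩
  have h3 := hf.convex_levelSet h0 s h1 (neg_mem_levelSet heven h2)
    (by norm_num : (0 : ℝ) ≤ 1 / 2) (by norm_num : (0 : ℝ) ≤ 1 / 2) (by norm_num)
  convert h3 using 1
  rw [map_neg]
  module

theorem integral_levelFun_ellipsoid (c : EuclideanSpace ℝ (Fin n))
    (T : EuclideanSpace ℝ (Fin n) ≃ₗ[ℝ] EuclideanSpace ℝ (Fin n)) (a : ℝ) :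
    ∫ x, levelFun (ellipsoid c T) a x =
      a * |LinearMap.det (T : EuclideanSpace ℝ (Fin n) →ₗ[ℝ] EuclideanSpace ℝ (Fin n))| *
        volume.real (unitBall n) := by
  have hT : Continuous T := T.toLinearMap.continuous_of_finiteDimensional
  have hmeas : MeasurableSet (ellipsoid c T) :=
    ((isCompact_closedBall _ _).image (continuous_const.add hT)).measurableSet
  have himg : ellipsoid c T = (fun x => c + x) '' (T '' unitBall n) := by
    rw [Set.image_image]
    rfl
  have hvol : volume.real (ellipsoid c T) =
      |LinearMap.det (T : EuclideanSpace ℝ (Fin n) →ₗ[ℝ] EuclideanSpace ℝ (Fin n))| *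
        volume.real (unitBall n) := by
    rw [himg, measureReal_def, Set.image_add_left, measure_preimage_add]
    have := Measure.addHaar_image_linearMap (volume : Measure (EuclideanSpace ℝ (Fin n)))
      (T : EuclideanSpace ℝ (Fin n) →ₗ[ℝ] EuclideanSpace ℝ (Fin n)) (unitBall n)
    rw [LinearEquiv.coe_coe] at this
    rw [this, ENNReal.toReal_mul, ENNReal.toReal_ofReal (abs_nonneg _), measureReal_def]
  unfold levelFun
  rw [integral_indicator_const _ hmeas, hvol, smul_eq_mul]
  ring

theorem volume_real_unitBall_pos : 0 < volume.real (unitBall n) := by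
  rw [measureReal_def, ENNReal.toReal_pos_iff]
  exact ⟨Metric.measure_closedBall_pos _ _ one_pos, measure_closedBall_lt_top⟩

theorem integral_levelFun_unitBall (a : ℝ) :
    ∫ x, levelFun (unitBall n) a x = a * volume.real (unitBall n) := by
  rw [unitBall_eq_ellipsoid, integral_levelFun_ellipsoid, ← unitBall_eq_ellipsoid]
  simp

theorem IsJohnEllipsoid.exp_mul_abs_det_le (hf : IsLogConcave f) (h0 : 0 < supNorm f) {s₀ s : ℝ}
    (hJ : IsJohnEllipsoid f (levelFun (unitBall n) (Real.exp s₀ * supNorm f)))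
    {T : EuclideanSpace ℝ (Fin n) ≃ₗ[ℝ] EuclideanSpace ℝ (Fin n)}
    (hT : ellipsoid 0 T ⊆ levelSet f (Real.exp s)) :
    Real.exp s * |LinearMap.det (T : EuclideanSpace ℝ (Fin n) →ₗ[ℝ] EuclideanSpace ℝ (Fin n))| ≤
      Real.exp s₀ := by
  have h := hJ.2.2 _ ⟨Real.exp s * supNorm f, mul_pos (Real.exp_pos s) h0, 0, T, rfl⟩
    ((levelFun_le_iff hf.1).2 hT)
  rw [integral_levelFun_ellipsoid, integral_levelFun_unitBall] at h
  have h1 := le_of_mul_le_mul_right h volume_real_unitBall_pos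
  rw [mul_right_comm] at h1
  exact le_of_mul_le_mul_right h1 h0

/-- The first order optimality condition at John's ellipsoid. -/
theorem IsJohnEllipsoid.sub_add_trace_le (hf : IsLogConcave f) (h0 : 0 < supNorm f) {s₀ s : ℝ}
    (hJ : IsJohnEllipsoid f (levelFun (unitBall n) (Real.exp s₀ * supNorm f)))
    (T : EuclideanSpace ℝ (Fin n) →ₗ[ℝ] EuclideanSpace ℝ (Fin n))
    (hT : ∀ x ∈ Metric.closedBall 0 1, T x ∈ levelSet f (Real.exp s)) :
    s - s₀ + LinearMap.trace ℝ _ T ≤ n := by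
  have hB : ∀ x ∈ Metric.closedBall 0 1, x ∈ levelSet f (Real.exp s₀) :=
    fun x hx => (levelFun_le_iff hf.1).1 hJ.2.1 hx
  set A : Matrix (Fin n) (Fin n) ℝ := Matrix.toEuclideanLin.symm T - 1 with hA
  have hAT : Matrix.toEuclideanLin A = T - LinearMap.id := by
    rw [hA, map_sub, LinearEquiv.apply_symm_apply]
    congr 1
    ext x
    simp
  have hAtr : A.trace = LinearMap.trace ℝ _ T - n := by
    rw [← Matrix.trace_toEuclideanLin, hAT, map_sub, LinearMap.trace_id,
      finrank_euclideanSpace_fin]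
  have hdet := Matrix.hasDerivAt_det_one_add_smul A
  have hone : (1 + (0 : ℝ) • A).det = 1 := by simp
  -- The logarithm of the integral, up to a constant, along the segment from (s₀, I) to (s, T). T
  -- itself may be singular; I + ε A is invertible for small ε.
  have hder : HasDerivAt (fun ε : ℝ => ε * (s - s₀) + Real.log (1 + ε • A).det)
      (s - s₀ + A.trace) 0 := by
    have h1 := (hasDerivAt_id (0 : ℝ)).mul_const (s - s₀)
    have h2 := hdet.log (by rw [hone]; exact one_ne_zero)
    rw [hone, div_one] at h2
    simpa [Pi.add_def] using h1.add h2
  have hpos : ∀ᶠ ε : ℝ in 𝓝 0, 0 < (1 + ε • A).det :=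
    hdet.continuousAt.eventually (lt_mem_nhds (by simp))
  have hslope := hder.tendsto_slope_zero_right
  have hle : s - s₀ + A.trace ≤ 0 := by
    refine le_of_tendsto hslope ?_
    filter_upwards [nhdsWithin_le_nhds hpos, self_mem_nhdsWithin,
      nhdsWithin_le_nhds (gt_mem_nhds (zero_lt_one (α := ℝ)))] with ε hε (hε0 : 0 < ε) hε1
    have hunit : IsUnit (LinearMap.det (Matrix.toEuclideanLin (1 + ε • A))) := by
      rw [Matrix.det_toEuclideanLin]
      exact hε.ne'.isUnit
    have hsub : ellipsoid 0 (LinearMap.equivOfIsUnitDet hunit) ⊆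
        levelSet f (Real.exp (ε * s + (1 - ε) * s₀)) := by
      rw [ellipsoid_zero_subset_iff]
      intro x hx
      convert hf.combo_mem_levelSet h0 (hT x hx) (hB x hx) hε0.le (sub_nonneg.2 hε1.le)
        (by ring) using 1
      rw [LinearMap.equivOfIsUnitDet_apply, map_add, map_smul, hAT]
      simp
      module
    have h := hJ.exp_mul_abs_det_le hf h0 hsub
    rw [LinearMap.coe_equivOfIsUnitDet, Matrix.det_toEuclideanLin, abs_of_pos hε] at h
    have hlog := Real.log_le_log (mul_pos (Real.exp_pos _) hε) h
    rw [Real.log_mul (Real.exp_ne_zero _) hε.ne', Real.log_exp, Real.log_exp] at hlog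
    simp only [zero_add, zero_mul, hone, Real.log_one, add_zero, sub_zero, smul_eq_mul]
    refine mul_nonpos_of_nonneg_of_nonpos (inv_nonneg.2 hε0.le) ?_
    linarith
  linarith

theorem exists_posDef_of_linearEquiv
    (T : EuclideanSpace ℝ (Fin n) ≃ₗ[ℝ] EuclideanSpace ℝ (Fin n)) :
    ∃ P : Matrix (Fin n) (Fin n) ℝ, P.PosDef ∧
      |LinearMap.det (T : EuclideanSpace ℝ (Fin n) →ₗ[ℝ] EuclideanSpace ℝ (Fin n))| = P.det ∧
      T '' Metric.closedBall 0 1 = Matrix.toEuclideanLin P '' Metric.closedBall 0 1 := by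
  have hA : Matrix.toEuclideanLin (Matrix.toEuclideanLin.symm (T : EuclideanSpace ℝ (Fin n) →ₗ[ℝ]
    EuclideanSpace ℝ (Fin n))) = (T : EuclideanSpace ℝ (Fin n) →ₗ[ℝ] EuclideanSpace ℝ (Fin n)) :=
    LinearEquiv.apply_symm_apply _ _
  have hdet := Matrix.det_toEuclideanLin (Matrix.toEuclideanLin.symm
    (T : EuclideanSpace ℝ (Fin n) →ₗ[ℝ] EuclideanSpace ℝ (Fin n)))
  rw [hA] at hdet
  obtain ⟨P, hP, hPdet, himg⟩ := Matrix.exists_posDef_image_closedBall_eq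
    (A := Matrix.toEuclideanLin.symm (T : EuclideanSpace ℝ (Fin n) →ₗ[ℝ] EuclideanSpace ℝ (Fin n)))
    (by rw [← hdet]; exact T.isUnit_det'.ne_zero)
  rw [hA] at himg
  exact ⟨P, hP, by rw [hdet, hPdet], himg⟩

/-- An ellipsoidal function below `f` is controlled by a positive definite matrix mapping the unit
ball to a level set of `f`. -/
theorem exists_level_of_ellipsoid_le (hf : IsLogConcave f) (heven : ∀ x, f (-x) = f x)
    (h0 : 0 < supNorm f) {a : ℝ} (ha : 0 < a) {c : EuclideanSpace ℝ (Fin n)}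
    {T : EuclideanSpace ℝ (Fin n) ≃ₗ[ℝ] EuclideanSpace ℝ (Fin n)}
    (h : ∀ x, levelFun (ellipsoid c T) a x ≤ f x) :
    ∃ s ≤ 0, a = Real.exp s * supNorm f ∧ ellipsoid c T ⊆ levelSet f (Real.exp s) ∧
      ∀ x ∈ T '' Metric.closedBall 0 1, x ∈ levelSet f (Real.exp s) := by
  have ha' : a = Real.exp (Real.log (a / supNorm f)) * supNorm f := by
    rw [Real.exp_log (div_pos ha h0), div_mul_cancel₀ _ h0.ne']
  rw [ha', levelFun_le_iff hf.1] at h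
  refine ⟨Real.log (a / supNorm f), ?_, ha', h, ?_⟩
  · have hne : (levelSet f (Real.exp (Real.log (a / supNorm f)))).Nonempty :=
      ⟨_, h ⟨0, by simp [unitBall], rfl⟩⟩
    by_contra! hlt
    rw [levelSet_eq_empty hf heven h0 (Real.one_lt_exp_iff.2 hlt)] at hne
    exact Set.not_nonempty_empty hne
  · have h1 := ellipsoid_zero_subset_iff.1 (ellipsoid_zero_subset_levelSet hf heven h0 h)
    rintro _ ⟨x, hx, rfl⟩
    exact h1 x hx

theorem isJohnEllipsoid_of_forall_posDef (hf : IsLogConcave f) (heven : ∀ x, f (-x) = f x)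
    (h0 : 0 < supNorm f) {s₀ : ℝ}
    (hB : ∀ x, levelFun (unitBall n) (Real.exp s₀ * supNorm f) x ≤ f x)
    (h : ∀ s ≤ 0, ∀ P : Matrix (Fin n) (Fin n) ℝ, P.PosDef →
      (∀ x ∈ Metric.closedBall 0 1, Matrix.toEuclideanLin P x ∈ levelSet f (Real.exp s)) →
        s - s₀ + P.trace ≤ n) :
    IsJohnEllipsoid f (levelFun (unitBall n) (Real.exp s₀ * supNorm f)) := by
  refine ⟨⟨_, mul_pos (Real.exp_pos _) h0, 0, LinearEquiv.refl ℝ _, by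
    rw [← unitBall_eq_ellipsoid]⟩, hB, ?_⟩
  rintro _ ⟨a, ha, c, T, rfl⟩ hle
  obtain ⟨s, hs, rfl, -, hT⟩ := exists_level_of_ellipsoid_le hf heven h0 ha hle
  obtain ⟨P, hP, hPdet, himg⟩ := exists_posDef_of_linearEquiv T
  rw [himg] at hT
  have h1 := h s hs P hP fun x hx => hT _ ⟨x, hx, rfl⟩
  have h2 := hP.log_det_le
  rw [integral_levelFun_ellipsoid, integral_levelFun_unitBall, hPdet]
  refine mul_le_mul_of_nonneg_right ?_ volume_real_unitBall_pos.le
  rw [mul_right_comm]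
  refine mul_le_mul_of_nonneg_right ?_ h0.le
  rw [← Real.exp_log hP.det_pos, ← Real.exp_add]
  exact Real.exp_le_exp.2 (by linarith)

/-- A second maximiser gives equality in log det P ≤ tr P - n, so P = 1 and s = s₀; only a
translation c remains to be excluded. -/
theorem IsJohnEllipsoid.unique (hf : IsLogConcave f) (heven : ∀ x, f (-x) = f x)
    (h0 : 0 < supNorm f) {s₀ : ℝ}
    (hJ : IsJohnEllipsoid f (levelFun (unitBall n) (Real.exp s₀ * supNorm f)))
    {g : EuclideanSpace ℝ (Fin n) → ℝ} (hg : IsJohnEllipsoid f g) :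
    g = levelFun (unitBall n) (Real.exp s₀ * supNorm f) := by
  obtain ⟨⟨a, ha, c, T, rfl⟩, hle, hmax⟩ := hg
  obtain ⟨s, hs, rfl, hcT, hT⟩ := exists_level_of_ellipsoid_le hf heven h0 ha hle
  obtain ⟨P, hP, hPdet, himg⟩ := exists_posDef_of_linearEquiv T
  rw [himg] at hT
  have h1 := hJ.sub_add_trace_le hf h0 (Matrix.toEuclideanLin P) fun x hx => hT _ ⟨x, hx, rfl⟩
  rw [Matrix.trace_toEuclideanLin] at h1
  have h2 := hmax _ hJ.1 hJ.2.1
  rw [integral_levelFun_ellipsoid, integral_levelFun_unitBall, hPdet,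
    mul_right_comm _ (supNorm f) P.det] at h2
  have h3 := le_of_mul_le_mul_right (le_of_mul_le_mul_right h2 volume_real_unitBall_pos) h0
  rw [← Real.exp_log hP.det_pos, ← Real.exp_add, Real.exp_le_exp] at h3
  have hP1 : P = 1 := hP.eq_one_of_le_log_det (by linarith)
  subst hP1
  simp only [Matrix.det_one, Real.log_one, Matrix.trace_one, Fintype.card_fin] at h1 h3
  have hs : s = s₀ := by linarith
  subst hs
  have himg' : T '' unitBall n = unitBall n := by
    rw [unitBall, himg]
    ext x
    simp
  have hE : ellipsoid c T = (fun x => c + x) '' unitBall n := by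
    rw [← himg', Set.image_image]
    rfl
  have hc : c = 0 := by
    by_contra hc
    have hcpos : 0 < ‖c‖ := norm_pos_iff.2 hc
    have hcB : ∀ x ∈ Metric.closedBall 0 1, c + x ∈ levelSet f (Real.exp s) := fun x hx =>
      hcT (hE ▸ ⟨x, hx, rfl⟩)
    set e := ‖c‖⁻¹ • c with he
    have hce : c = ‖c‖ • e := by rw [he, smul_inv_smul₀ hcpos.ne']
    have hene : ‖e‖ = 1 := by
      rw [he, norm_smul, norm_inv, norm_norm, inv_mul_cancel₀ hcpos.ne']
    -- If c ≠ 0, K contains c + B and -c + B. Their convex hull contains the image of B under x ↦ x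
    -- + ⟨e, x⟩ c, a map of trace n + ‖c‖.
    have h4 := hJ.sub_add_trace_le hf h0 (s := s)
      (LinearMap.id + ((innerₛₗ ℝ e).smulRight c)) (fun x hx => by
        have hx1 : ‖x‖ ≤ 1 := by simpa using hx
        have hin := abs_le.1 ((abs_real_inner_le_norm e x).trans
          (show ‖e‖ * ‖x‖ ≤ 1 by rwa [hene, one_mul]))
        set r := inner ℝ e x with hr
        have hm1 := hcB x hx
        have hm2 := neg_mem_levelSet heven (hcB (-x) (by simpa using hx))
        have := hf.convex_levelSet h0 s hm1 hm2 (a := (1 + r) / 2) (b := (1 - r) / 2)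
          (by linarith) (by linarith) (by ring)
        convert this using 1
        simp only [LinearMap.add_apply, LinearMap.id_apply, LinearMap.smulRight_apply,
          innerₛₗ_apply_apply, ← hr]
        module)
    rw [map_add, LinearMap.trace_id, LinearMap.trace_smulRight, finrank_euclideanSpace_fin,
      innerₛₗ_apply_apply] at h4
    have h5 : inner ℝ e c = ‖c‖ := by
      nth_rewrite 1 [hce]
      rw [inner_smul_right, real_inner_self_eq_norm_sq, hene]
      simp
    rw [h5] at h4
    linarith
  rw [hE, hc]
  simp

/-! ### One-sided derivatives in the variable log t. -/

theorem slope_eq_slope_comp_exp_mul (F : ℝ → ℝ) {t₀ t : ℝ} (ht₀ : 0 < t₀) (ht : 0 < t)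
    (hne : t ≠ t₀) :
    (F t - F t₀) / (t - t₀) =
      slope (F ∘ Real.exp) (Real.log t₀) (Real.log t) * slope Real.log t₀ t := by
  have h1 : Real.log t - Real.log t₀ ≠ 0 :=
    sub_ne_zero.2 fun h => hne (Real.log_injOn_pos ht ht₀ h)
  rw [slope_def_field, slope_def_field, Function.comp, Function.comp, Real.exp_log ht,
    Real.exp_log ht₀, div_mul_div_cancel₀ h1]

theorem tendsto_slope_of_tendsto_slope_comp_exp {F : ℝ → ℝ} {t₀ : ℝ} (ht₀ : 0 < t₀)
    {l l' : Filter ℝ} (hl : l ≤ 𝓝[≠] t₀) (hlog : Tendsto Real.log l l') {D : EReal}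
    (h : Tendsto (fun s => ((slope (F ∘ Real.exp) (Real.log t₀) s : ℝ) : EReal)) l' (𝓝 D)) :
    Tendsto (fun t => (((F t - F t₀) / (t - t₀) : ℝ) : EReal)) l (𝓝 (D * (t₀⁻¹ : ℝ))) := by
  have h1 : Tendsto (fun t => ((slope Real.log t₀ t : ℝ) : EReal)) l (𝓝 ((t₀⁻¹ : ℝ) : EReal)) :=
    (continuous_coe_real_ereal.tendsto _).comp
      ((hasDerivAt_iff_tendsto_slope.1 (Real.hasDerivAt_log ht₀.ne')).mono_left hl)
  have hne : ((t₀⁻¹ : ℝ) : EReal) ≠ 0 := by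
    exact_mod_cast (inv_pos.2 ht₀).ne'
  have h2 := EReal.Tendsto.mul (h.comp hlog) h1 (Or.inr (EReal.coe_ne_bot _))
    (Or.inr (EReal.coe_ne_top _)) (Or.inr hne) (Or.inr hne)
  refine h2.congr' ?_
  filter_upwards [hl self_mem_nhdsWithin,
    hl (nhdsWithin_le_nhds (lt_mem_nhds ht₀))] with t hne ht
  rw [slope_eq_slope_comp_exp_mul F ht₀ ht hne, EReal.coe_mul]
  rfl

theorem tendsto_log_nhdsLT {t₀ : ℝ} (ht₀ : 0 < t₀) :
    Tendsto Real.log (𝓝[<] t₀) (𝓝[<] Real.log t₀) := by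
  refine tendsto_nhdsWithin_iff.2 ⟨(Real.continuousAt_log ht₀.ne').tendsto.mono_left
    nhdsWithin_le_nhds, ?_⟩
  filter_upwards [self_mem_nhdsWithin, nhdsWithin_le_nhds (lt_mem_nhds ht₀)] with t h1 h2
  exact Real.log_lt_log h2 h1

theorem tendsto_log_nhdsGT {t₀ : ℝ} (ht₀ : 0 < t₀) :
    Tendsto Real.log (𝓝[>] t₀) (𝓝[>] Real.log t₀) := by
  refine tendsto_nhdsWithin_iff.2 ⟨(Real.continuousAt_log ht₀.ne').tendsto.mono_left
    nhdsWithin_le_nhds, ?_⟩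
  filter_upwards [self_mem_nhdsWithin] with t h1
  exact Real.log_lt_log ht₀ h1

theorem exists_hasLeftDeriv_of_concaveOn_comp_exp {F : ℝ → ℝ}
    (hF : ConcaveOn ℝ (Set.Iic 0) (F ∘ Real.exp)) {t₀ : ℝ} (ht₀ : 0 < t₀) (ht₁ : t₀ ≤ 1) :
    ∃ D, HasLeftDeriv F t₀ D := by
  set s₀ := Real.log t₀ with hs₀
  have hs : s₀ ≤ 0 := Real.log_nonpos ht₀.le ht₁
  have hanti : AntitoneOn (fun s => ((slope (F ∘ Real.exp) s₀ s : ℝ) : EReal))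
      (Set.Ioo (s₀ - 1) s₀) := fun x hx y hy hxy => EReal.coe_le_coe_iff.2
    (hF.antitoneOn_slope_lt hs ⟨hx.2.le.trans hs, hx.2⟩ ⟨hy.2.le.trans hs, hy.2⟩ hxy)
  -- Antitone slopes are monotone into the order dual, and in `EReal` every set is bounded.
  have h := MonotoneOn.tendsto_nhdsWithin_Ioo_left (β := ERealᵒᵈ)
    (Set.nonempty_Ioo.2 (sub_one_lt s₀)) hanti.dual_right (OrderTop.bddAbove _)
  exact ⟨_, tendsto_slope_of_tendsto_slope_comp_exp ht₀
    (nhdsWithin_mono _ fun t (ht : t < t₀) => ht.ne) (tendsto_log_nhdsLT ht₀) h⟩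

theorem exists_hasRightDeriv_of_concaveOn_comp_exp {F : ℝ → ℝ}
    (hF : ConcaveOn ℝ (Set.Iic 0) (F ∘ Real.exp)) {t₀ : ℝ} (ht₀ : 0 < t₀) (ht₁ : t₀ < 1) :
    ∃ D, HasRightDeriv F t₀ D := by
  set s₀ := Real.log t₀ with hs₀
  have hs : s₀ < 0 := Real.log_neg ht₀ ht₁
  have hanti : AntitoneOn (fun s => ((slope (F ∘ Real.exp) s₀ s : ℝ) : EReal))
      (Set.Ioo s₀ 0) := fun x hx y hy hxy => EReal.coe_le_coe_iff.2
    (hF.antitoneOn_slope_gt hs.le ⟨hx.2.le, hx.1⟩ ⟨hy.2.le, hy.1⟩ hxy)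
  have h := MonotoneOn.tendsto_nhdsWithin_Ioo_right (β := ERealᵒᵈ)
    (Set.nonempty_Ioo.2 hs) hanti.dual_right (OrderBot.bddBelow _)
  exact ⟨_, tendsto_slope_of_tendsto_slope_comp_exp ht₀
    (nhdsWithin_mono _ fun t (ht : t₀ < t) => ht.ne') (tendsto_log_nhdsGT ht₀) h⟩

/-! ### The inradius of the level sets. -/

theorem bddAbove_radii_levelSet (hn : 1 ≤ n) (hint : Integrable f) (hf : IsLogConcave f)
    (h0 : 0 < supNorm f) {t : ℝ} (ht : 0 < t) :
    BddAbove {ρ : ℝ | 0 ≤ ρ ∧ Metric.closedBall 0 ρ ⊆ levelSet f t} := by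
  by_contra hbdd
  rw [not_bddAbove_iff] at hbdd
  -- Unbounded radii would bound f below by a positive constant, contradicting integrability on a
  -- space of infinite measure.
  have huniv : ∀ x, t * supNorm f ≤ f x := by
    intro x
    obtain ⟨ρ, ⟨-, hρ⟩, hlt⟩ := hbdd ‖x‖
    exact hρ (mem_closedBall_zero_iff.2 hlt.le)
  have hpos := mul_pos ht h0
  have hconst : Integrable fun _ : EuclideanSpace ℝ (Fin n) => t * supNorm f :=
    hint.mono aestronglyMeasurable_const <| .of_forall fun x => by
      rw [Real.norm_of_nonneg hpos.le, Real.norm_of_nonneg (hf.1 x)]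
      exact huniv x
  have : Nonempty (Fin n) := ⟨⟨0, hn⟩⟩
  rw [integrable_const_iff_isFiniteMeasure hpos.ne'] at hconst
  have h1 := measure_lt_top (volume : Measure (EuclideanSpace ℝ (Fin n))) Set.univ
  rw [measure_univ_of_isAddLeftInvariant] at h1
  exact h1.ne rfl

theorem zero_mem_radii_levelSet (hf : IsLogConcave f) (heven : ∀ x, f (-x) = f x) {t : ℝ}
    (ht : t ≤ 1) : (0 : ℝ) ∈ {ρ : ℝ | 0 ≤ ρ ∧ Metric.closedBall 0 ρ ⊆ levelSet f t} :=
  ⟨le_rfl, by simpa using zero_mem_levelSet hf heven ht⟩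

open scoped Pointwise in
theorem concaveOn_inradius_levelSet_exp (hn : 1 ≤ n) (hint : Integrable f) (hf : IsLogConcave f)
    (heven : ∀ x, f (-x) = f x) (h0 : 0 < supNorm f) :
    ConcaveOn ℝ (Set.Iic 0) ((fun t => inradius (levelSet f t)) ∘ Real.exp) := by
  refine ⟨convex_Iic 0, fun s (hs : s ≤ 0) s' (hs' : s' ≤ 0) a b ha hb hab => ?_⟩
  simp only [Function.comp, inradius]
  have hne := zero_mem_radii_levelSet hf heven (Real.exp_le_one_iff.2 hs)
  have hne' := zero_mem_radii_levelSet hf heven (Real.exp_le_one_iff.2 hs')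
  have hbd := bddAbove_radii_levelSet hn hint hf h0 (Real.exp_pos s)
  have hbd' := bddAbove_radii_levelSet hn hint hf h0 (Real.exp_pos s')
  rw [← Real.sSup_smul_of_nonneg ha, ← Real.sSup_smul_of_nonneg hb,
    ← csSup_add (Set.Nonempty.smul_set ⟨0, hne⟩) (hbd.smul_of_nonneg ha)
      (Set.Nonempty.smul_set ⟨0, hne'⟩) (hbd'.smul_of_nonneg hb)]
  refine csSup_le_csSup (bddAbove_radii_levelSet hn hint hf h0 (Real.exp_pos _))
    (Set.Nonempty.add (Set.Nonempty.smul_set ⟨0, hne⟩) (Set.Nonempty.smul_set ⟨0, hne'⟩)) ?_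
  rintro _ ⟨_, ⟨ρ, ⟨hρ, hρB⟩, rfl⟩, _, ⟨ρ', ⟨hρ', hρB'⟩, rfl⟩, rfl⟩
  simp only [smul_eq_mul]
  refine ⟨by positivity, fun x hx => ?_⟩
  rw [mem_closedBall_zero_iff] at hx
  by_cases hr : a * ρ + b * ρ' = 0
  · have hx0 : x = 0 := norm_le_zero_iff.1 (hr ▸ hx)
    rw [hx0]
    have h1 := hρB (Metric.mem_closedBall_self hρ)
    have h2 := hρB' (Metric.mem_closedBall_self hρ')
    simpa using hf.combo_mem_levelSet h0 h1 h2 ha hb hab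
  · have hrpos : 0 < a * ρ + b * ρ' := lt_of_le_of_ne (by positivity) (Ne.symm hr)
    -- Splits x as a (ρ y) + b (ρ' y) with ‖y‖ ≤ 1.
    set y := (a * ρ + b * ρ')⁻¹ • x with hy
    have hy1 : ‖y‖ ≤ 1 := by
      rw [hy, norm_smul, norm_inv, Real.norm_of_nonneg hrpos.le]
      exact inv_mul_le_one_of_le₀ hx hrpos.le
    have hmem : ∀ r, 0 ≤ r → r • y ∈ Metric.closedBall (0 : EuclideanSpace ℝ (Fin n)) r := by
      intro r hr
      rw [mem_closedBall_zero_iff, norm_smul, Real.norm_of_nonneg hr]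
      exact mul_le_of_le_one_right hr hy1
    have := hf.combo_mem_levelSet h0 (hρB (hmem ρ hρ)) (hρB' (hmem ρ' hρ')) ha hb hab
    convert this using 1
    rw [smul_smul a, smul_smul b, ← add_smul, hy, smul_inv_smul₀ hr]

theorem one_le_inradius (hn : 1 ≤ n) (hint : Integrable f) (hf : IsLogConcave f)
    (h0 : 0 < supNorm f) {t : ℝ} (ht : 0 < t) (hB : Metric.closedBall 0 1 ⊆ levelSet f t) :
    1 ≤ inradius (levelSet f t) :=
  le_csSup (bddAbove_radii_levelSet hn hint hf h0 ht) ⟨zero_le_one, hB⟩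

theorem hasRightDeriv_inradius_levelSet_one (hn : 1 ≤ n) (hint : Integrable f)
    (hf : IsLogConcave f) (heven : ∀ x, f (-x) = f x) (h0 : 0 < supNorm f)
    (hB : Metric.closedBall 0 1 ⊆ levelSet f 1) :
    HasRightDeriv (fun t => inradius (levelSet f t)) 1 ⊥ := by
  have hr := one_le_inradius hn hint hf h0 one_pos hB
  have hempty : inradius (∅ : Set (EuclideanSpace ℝ (Fin n))) = 0 := by
    have : {ρ : ℝ | 0 ≤ ρ ∧ Metric.closedBall (0 : EuclideanSpace ℝ (Fin n)) ρ ⊆ ∅} = ∅ := by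
      refine Set.eq_empty_of_forall_notMem fun ρ hρ => ?_
      exact hρ.2 (Metric.mem_closedBall_self hρ.1)
    rw [inradius, this, Real.sSup_empty]
  have hinv : Tendsto (fun t : ℝ => (t - 1)⁻¹) (𝓝[>] 1) atTop := by
    refine tendsto_inv_nhdsGT_zero.comp (tendsto_nhdsWithin_iff.2 ⟨?_, ?_⟩)
    · have : Tendsto (fun t : ℝ => t - 1) (𝓝 1) (𝓝 (1 - 1)) := tendsto_id.sub_const 1
      rw [sub_self] at this
      exact this.mono_left nhdsWithin_le_nhds
    · filter_upwards [self_mem_nhdsWithin] with t (ht : 1 < t)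
      exact sub_pos.2 ht
  have h := EReal.tendsto_coe_nhds_bot_iff.2 (hinv.const_mul_atTop_of_neg
    (by linarith : -inradius (levelSet f 1) < 0))
  refine h.congr' ?_
  filter_upwards [self_mem_nhdsWithin] with t ht
  simp only [levelSet_eq_empty hf heven h0 ht, hempty]
  rw [zero_sub, div_eq_mul_inv]

theorem IsJohnEllipsoid.inradius_le (hn : 1 ≤ n) (hf : IsLogConcave f)
    (heven : ∀ x, f (-x) = f x) (h0 : 0 < supNorm f) {t₀ t : ℝ} (ht₀ : 0 < t₀)
    (hJ : IsJohnEllipsoid f (levelFun (unitBall n) (t₀ * supNorm f))) (ht : 0 < t) (ht1 : t ≤ 1) :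
    inradius (levelSet f t) ≤ 1 - (Real.log t - Real.log t₀) / n := by
  have hn0 : (0 : ℝ) < n := by exact_mod_cast hn
  refine csSup_le ⟨0, zero_mem_radii_levelSet hf heven ht1⟩ ?_
  rintro ρ ⟨hρ, hB⟩
  rw [← Real.exp_log ht₀] at hJ
  have h := hJ.sub_add_trace_le hf h0 (s := Real.log t) (ρ • LinearMap.id) fun x hx => by
    rw [Real.exp_log ht]
    apply hB
    rw [mem_closedBall_zero_iff] at hx ⊢
    rw [LinearMap.smul_apply, LinearMap.id_apply, norm_smul, Real.norm_of_nonneg hρ]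
    exact mul_le_of_le_one_right hρ hx
  rw [map_smul, LinearMap.trace_id, finrank_euclideanSpace_fin, smul_eq_mul] at h
  rw [le_sub_iff_add_le, ← le_sub_iff_add_le', div_le_iff₀ hn0]
  linarith

/-- F touches the logarithmic bound from below at t₀, so the difference quotients compare, in
opposite directions on the two sides. At t₀ = 1 the bound says nothing on the right, hence the last
hypothesis. -/
theorem le_and_le_of_le_sub_log {F : ℝ → ℝ} {t₀ κ : ℝ} (ht₀ : t₀ ∈ Set.Ioc (0 : ℝ) 1)
    (h1 : 1 ≤ F t₀)
    (hF : ∀ t ∈ Set.Ioc (0 : ℝ) 1, F t ≤ 1 - (Real.log t - Real.log t₀) / κ) {Dr Dl : EReal}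
    (hDr : HasRightDeriv F t₀ Dr) (hDl : HasLeftDeriv F t₀ Dl) (hbot : t₀ = 1 → Dr = ⊥) :
    (t₀ : EReal) * Dr ≤ ((-(1 / κ) : ℝ) : EReal) ∧ ((-(1 / κ) : ℝ) : EReal) ≤ (t₀ : EReal) * Dl := by
  have hF0 : F t₀ = 1 := le_antisymm (by simpa using hF t₀ ht₀) h1
  have hpos : (0 : EReal) ≤ t₀ := by exact_mod_cast ht₀.1.le
  have hval : ((-(1 / κ) : ℝ) : EReal) = (t₀ : EReal) * ((-(1 / κ) * t₀⁻¹ : ℝ) : EReal) := by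
    rw [← EReal.coe_mul, mul_comm (-(1 / κ)), mul_inv_cancel_left₀ ht₀.1.ne']
  have hlim : Tendsto (fun t => ((-(1 / κ) * slope Real.log t₀ t : ℝ) : EReal)) (𝓝[≠] t₀)
      (𝓝 ((-(1 / κ) * t₀⁻¹ : ℝ) : EReal)) :=
    (continuous_coe_real_ereal.tendsto _).comp
      ((hasDerivAt_iff_tendsto_slope.1 (Real.hasDerivAt_log ht₀.1.ne')).const_mul _)
  have hdiff : ∀ t ∈ Set.Ioc (0 : ℝ) 1, F t - F t₀ ≤ -(1 / κ) * (Real.log t - Real.log t₀) := by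
    intro t ht
    have := hF t ht
    rw [hF0]
    linarith [show (Real.log t - Real.log t₀) / κ = 1 / κ * (Real.log t - Real.log t₀) by ring]
  rw [hval]
  constructor
  · rcases eq_or_lt_of_le ht₀.2 with h | h
    · rw [hbot h, EReal.coe_mul_bot_of_pos ht₀.1]
      exact bot_le
    · refine mul_le_mul_of_nonneg_left (le_of_tendsto_of_tendsto hDr
        (hlim.mono_left (nhdsWithin_mono _ fun t (ht : t₀ < t) => ht.ne')) ?_) hpos
      filter_upwards [self_mem_nhdsWithin, nhdsWithin_le_nhds (gt_mem_nhds h)]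
        with t (ht : t₀ < t) ht1
      rw [EReal.coe_le_coe_iff, slope_def_field, ← mul_div_assoc]
      exact div_le_div_of_nonneg_right (hdiff t ⟨ht₀.1.trans ht, ht1.le⟩) (sub_pos.2 ht).le
  · have hlim' := hlim.mono_left (nhdsWithin_mono t₀ fun t (ht : t ∈ Set.Iio t₀) => ne_of_lt ht)
    refine mul_le_mul_of_nonneg_left (le_of_tendsto_of_tendsto hlim' hDl ?_) hpos
    filter_upwards [self_mem_nhdsWithin, nhdsWithin_le_nhds (lt_mem_nhds ht₀.1)]
      with t (ht : t < t₀) ht0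
    rw [EReal.coe_le_coe_iff, slope_def_field, ← mul_div_assoc]
    exact div_le_div_of_nonpos_of_le (sub_neg.2 ht).le (hdiff t ⟨ht0, ht.le.trans ht₀.2⟩)

/-! ### The two implications. -/

theorem sum_inner_map_eq_trace {ι : Type*} [Fintype ι] (c : ι → ℝ)
    (u : ι → EuclideanSpace ℝ (Fin n))
    (h : (1 : Matrix (Fin n) (Fin n) ℝ) = ∑ j, c j • Matrix.vecMulVec (u j) (u j))
    (T : EuclideanSpace ℝ (Fin n) →ₗ[ℝ] EuclideanSpace ℝ (Fin n)) :
    ∑ j, c j * inner ℝ (T (u j)) (u j) = LinearMap.trace ℝ _ T := by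
  have := Matrix.sum_inner_eq_trace c u h (Matrix.toEuclideanLin.symm T)
  rwa [← Matrix.trace_toEuclideanLin, LinearEquiv.apply_symm_apply] at this

theorem isJohnEllipsoid_of_decomposition (hf : IsLogConcave f) (heven : ∀ x, f (-x) = f x)
    (h0 : 0 < supNorm f) {t₀ : ℝ} (ht₀ : 0 < t₀)
    (hB : ∀ x, levelFun (unitBall n) (t₀ * supNorm f) x ≤ f x) {m : ℕ} {m' : Fin m → ℕ}
    {u : (i : Fin m) → Fin (m' i) → EuclideanSpace ℝ (Fin n)} {l : Fin m → ℝ}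
    {μ : (i : Fin m) → Fin (m' i) → ℝ} {α : Fin m → ℝ} (hu : ∀ i j, ‖u i j‖ = 1)
    (hl : ∀ i, 0 < l i)
    (hlα : ∑ i, l i * α i = -1)
    (hI : (1 : Matrix (Fin n) (Fin n) ℝ) =
      ∑ i, ∑ j, (l i * μ i j) • Matrix.vecMulVec (u i j) (u i j))
    (h : ∀ t ∈ Set.Ioc (0 : ℝ) 1, ∀ i,
      ∀ T : EuclideanSpace ℝ (Fin n) ≃ₗ[ℝ] EuclideanSpace ℝ (Fin n),
        ellipsoid 0 T ⊆ levelSet f t →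
        -α i * Real.log (t / t₀) + ∑ j, μ i j * inner ℝ (T (u i j)) (u i j) ≤ ∑ j, μ i j) :
    IsJohnEllipsoid f (levelFun (unitBall n) (t₀ * supNorm f)) := by
  have hI' : (1 : Matrix (Fin n) (Fin n) ℝ) = ∑ p : (i : Fin m) × Fin (m' i),
      (l p.1 * μ p.1 p.2) • Matrix.vecMulVec (u p.1 p.2) (u p.1 p.2) := by
    rw [hI, Fintype.sum_sigma]
  rw [← Real.exp_log ht₀] at hB ⊢
  refine isJohnEllipsoid_of_forall_posDef hf heven h0 hB fun s hs P hP hPK => ?_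
  have hunit : IsUnit (LinearMap.det (Matrix.toEuclideanLin P)) := by
    rw [Matrix.det_toEuclideanLin]
    exact hP.det_pos.ne'.isUnit
  have hi := fun i => h (Real.exp s) ⟨Real.exp_pos s, Real.exp_le_one_iff.2 hs⟩ i
    (LinearMap.equivOfIsUnitDet hunit) (ellipsoid_zero_subset_iff.2 (by simpa using hPK))
  rw [Real.log_div (Real.exp_ne_zero s) ht₀.ne', Real.log_exp] at hi
  simp only [LinearMap.equivOfIsUnitDet_apply] at hi
  have hsum := Finset.sum_le_sum fun i (_ : i ∈ Finset.univ) =>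
    mul_le_mul_of_nonneg_left (hi i) (hl i).le
  have htr := sum_inner_map_eq_trace (fun p : (i : Fin m) × Fin (m' i) => l p.1 * μ p.1 p.2)
    (fun p => u p.1 p.2) hI' (Matrix.toEuclideanLin P)
  -- The trace identity for T = I: the weights λ_i μ_ij add up to n.
  have hlμ := sum_inner_map_eq_trace (fun p : (i : Fin m) × Fin (m' i) => l p.1 * μ p.1 p.2)
    (fun p => u p.1 p.2) hI' LinearMap.id
  simp only [LinearMap.id_apply, real_inner_self_eq_norm_sq, hu, one_pow, mul_one,
    LinearMap.trace_id, finrank_euclideanSpace_fin, Fintype.sum_sigma] at hlμ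
  rw [Matrix.trace_toEuclideanLin, Fintype.sum_sigma] at htr
  simp only [mul_assoc] at htr
  simp only [mul_add, Finset.sum_add_distrib, Finset.mul_sum] at hsum
  rw [hlμ] at hsum
  have hα : ∑ i, l i * (-α i * (s - Real.log t₀)) = s - Real.log t₀ := by
    rw [show (∑ i, l i * (-α i * (s - Real.log t₀))) = -(∑ i, l i * α i) * (s - Real.log t₀) by
      rw [← Finset.sum_neg_distrib, Finset.sum_mul]
      exact Finset.sum_congr rfl fun i _ => by ring, hlα]
    ring
  rw [hα] at hsum
  exact (add_le_add_right htr.symm.le _).trans hsum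

theorem IsJohnEllipsoid.exists_decomposition (hn : 1 ≤ n) (hf : IsLogConcave f)
    (h0 : 0 < supNorm f) {t₀ : ℝ} (ht₀ : 0 < t₀)
    (hJ : IsJohnEllipsoid f (levelFun (unitBall n) (t₀ * supNorm f))) :
    ∃ (k : ℕ) (u : Fin k → EuclideanSpace ℝ (Fin n)) (c : Fin k → ℝ),
      (n ≤ k ∧ k ≤ n * (n + 1) / 2) ∧
      (∀ j, u j ∈ frontier (levelSet f t₀) ∩ Metric.sphere 0 1) ∧ (∀ j, 0 < c j) ∧
      (1 : Matrix (Fin n) (Fin n) ℝ) = ∑ j, (n * c j) • Matrix.vecMulVec (u j) (u j) ∧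
      ∀ t, 0 < t → ∀ T : EuclideanSpace ℝ (Fin n) ≃ₗ[ℝ] EuclideanSpace ℝ (Fin n),
        ellipsoid 0 T ⊆ levelSet f t →
          1 / n * Real.log (t / t₀) + ∑ j, c j * inner ℝ (T (u j)) (u j) ≤ ∑ j, c j := by
  have hn0 : (0 : ℝ) < n := by exact_mod_cast hn
  have hB : Metric.closedBall 0 1 ⊆ levelSet f t₀ := (levelFun_le_iff hf.1).1 hJ.2.1
  have hlin := fun (t : ℝ) (ht : 0 < t) T (hT : ∀ x ∈ Metric.closedBall 0 1, T x ∈ levelSet f t) =>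
    IsJohnEllipsoid.sub_add_trace_le hf h0 (s₀ := Real.log t₀) (s := Real.log t)
      (by rwa [Real.exp_log ht₀]) T (by rwa [Real.exp_log ht])
  obtain ⟨k, u, c, hk, hu, hc, hc1, hI⟩ := exists_john_decomposition hn hB fun T hT => by
    simpa using hlin t₀ ht₀ T hT
  refine ⟨k, u, c, hk, hu, hc, hI, fun t ht T hT => ?_⟩
  have h := hlin t ht T (ellipsoid_zero_subset_iff.1 hT)
  rw [← sum_inner_map_eq_trace _ u hI] at h
  simp only [mul_assoc, ← Finset.mul_sum, LinearEquiv.coe_coe] at h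
  -- As ∑ c = 1, the claim is (*) divided by n.
  rw [hc1, Real.log_div ht.ne' ht₀.ne', ← mul_le_mul_iff_right₀ hn0, mul_add, ← mul_assoc,
    mul_one_div_cancel hn0.ne', one_mul, mul_one]
  exact h

end LogConcave

theorem theorem4 (n : ℕ) (hn : 1 ≤ n) (f : EuclideanSpace ℝ (Fin n) → ℝ)
    (hf_ne : f ≠ 0) (hf_even : ∀ x, f (-x) = f x) (hf_int : Integrable f) (hf_lc : IsLogConcave f)
    (t₀ : ℝ) (ht₀ : t₀ ∈ Set.Ioc (0 : ℝ) 1)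
    (hball : ∀ x, levelFun (unitBall n) (t₀ * supNorm f) x ≤ f x) :
    ∃ Dr Dl : EReal,
      -- the one-sided derivatives of the inradius of `K_t(f)` at `t₀`
      HasRightDeriv (fun t => inradius (levelSet f t)) t₀ Dr ∧
      HasLeftDeriv (fun t => inradius (levelSet f t)) t₀ Dl ∧
      -- the maximal ellipsoid of `f` is unique when it is a multiple of the unit ball
      (∀ g, IsJohnEllipsoid f (levelFun (unitBall n) (t₀ * supNorm f)) →
        IsJohnEllipsoid f g → g = levelFun (unitBall n) (t₀ * supNorm f)) ∧
      -- the characterization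
      (IsJohnEllipsoid f (levelFun (unitBall n) (t₀ * supNorm f)) ↔
        ∃ (m : ℕ) (m' : Fin m → ℕ)
          (u : (i : Fin m) → Fin (m' i) → EuclideanSpace ℝ (Fin n))
          (l : Fin m → ℝ) (μ : (i : Fin m) → Fin (m' i) → ℝ) (α : Fin m → ℝ),
          (1 ≤ m ∧ m ≤ 1 + n * (n + 1) / 2) ∧
          (∀ i, n ≤ m' i ∧ m' i ≤ n * (n + 1) / 2) ∧
          (∀ i j, u i j ∈ frontier (levelSet f t₀) ∩ Metric.sphere 0 1) ∧
          (∀ i, 0 < l i) ∧ (∀ i j, 0 < μ i j) ∧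
          (∀ i, (t₀ : EReal) * Dr ≤ (α i : EReal) ∧ (α i : EReal) ≤ (t₀ : EReal) * Dl) ∧
          ∑ i, l i * α i = -1 ∧
          (1 : Matrix (Fin n) (Fin n) ℝ) =
            ∑ i, ∑ j, (l i * μ i j) • Matrix.vecMulVec (u i j) (u i j) ∧
          ∀ t ∈ Set.Ioc (0 : ℝ) 1, ∀ i,
            ∀ T : EuclideanSpace ℝ (Fin n) ≃ₗ[ℝ] EuclideanSpace ℝ (Fin n),
              ellipsoid 0 T ⊆ levelSet f t →
              -α i * Real.log (t / t₀) + ∑ j, μ i j * inner ℝ (T (u i j)) (u i j)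
                ≤ ∑ j, μ i j) := by
  have h0 := hf_lc.supNorm_pos hf_even hf_ne
  have hB : Metric.closedBall 0 1 ⊆ levelSet f t₀ := (levelFun_le_iff hf_lc.1).1 hball
  have hconc := concaveOn_inradius_levelSet_exp hn hf_int hf_lc hf_even h0
  have hDr : ∃ Dr, HasRightDeriv (fun t => inradius (levelSet f t)) t₀ Dr ∧
      (t₀ = 1 → Dr = ⊥) := by
    rcases eq_or_lt_of_le ht₀.2 with rfl | h
    · exact ⟨⊥, hasRightDeriv_inradius_levelSet_one hn hf_int hf_lc hf_even h0 hB, fun _ => rfl⟩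
    · obtain ⟨D, hD⟩ := exists_hasRightDeriv_of_concaveOn_comp_exp hconc ht₀.1 h
      exact ⟨D, hD, fun h1 => absurd h1 h.ne⟩
  obtain ⟨Dr, hDr, hbot⟩ := hDr
  obtain ⟨Dl, hDl⟩ := exists_hasLeftDeriv_of_concaveOn_comp_exp hconc ht₀.1 ht₀.2
  refine ⟨Dr, Dl, hDr, hDl, fun g hJ hg => ?_, fun hJ => ?_, ?_⟩
  · rw [← Real.exp_log ht₀.1] at hJ ⊢
    exact hJ.unique hf_lc hf_even h0 hg
  · have hn0 : (0 : ℝ) < n := by exact_mod_cast hn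
    obtain ⟨k, u, c, hk, hu, hc, hI, hT⟩ := hJ.exists_decomposition hn hf_lc h0 ht₀.1
    have hα := le_and_le_of_le_sub_log (κ := n) ht₀
      (one_le_inradius hn hf_int hf_lc h0 ht₀.1 hB)
      (fun t ht => hJ.inradius_le hn hf_lc hf_even h0 ht₀.1 ht.1 ht.2) hDr hDl hbot
    -- A single block suffices: λ = n and α = -1/n, with John's weights c as μ.
    refine ⟨1, fun _ => k, fun _ => u, fun _ => n, fun _ => c, fun _ => -(1 / n),
      ⟨le_rfl, Nat.le_add_right _ _⟩, fun _ => hk, fun _ => hu, fun _ => hn0, fun _ => hc,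
      fun _ => hα, ?_, ?_, fun t ht _ T hTK => ?_⟩
    · simp [hn0.ne']
    · simpa using hI
    · rw [neg_neg]
      exact hT t ht.1 T hTK
  · rintro ⟨m, m', u, l, μ, α, -, -, hu, hl, -, -, hlα, hI, h⟩
    exact isJohnEllipsoid_of_decomposition hf_lc hf_even h0 ht₀.1 hball
      (fun i j => by simpa using (hu i j).2) hl hlα hI h
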